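/- Let $\mathbf E_1^3$ be $\mathbb R^3$ with the Lorentzian metric $\langle v,w\rangle=v_1w_1+v_2w_2-v_3w_3$. Let $P$ be a spacelike plane in $\mathbf E_1^3$, given by a point $o$ and a Lorentz-orthonormal basis $e_1,e_2,e_3$ with $e_1,e_2$ tangent to $P$ and $\langle e_3,e_3\rangle=-1$ (for instance the plane $z=0$ with $o=0$ and the usual basis). A compact spacelike graph on $P$ is a set $$S=\{\,o+x e_1+y e_2+u(x,y)e_3:\ (x,y)\in\overline\Omega\,\},$$ where $\Omega\subset\mathbb R^2$ is a bounded domain with smooth boundary and $u$ is a smooth function on $\overline\Omega$ such that all tangent planes of $S$ (also at boundary points) are spacelike; its boundary $\partial S$ is the part of $S$ that lies over $\partial\Omega$. The mean curvature of $S$ is $$H=-\frac12\,\frac{eG-2fF+gE}{EG-F^2},$$ where $E,F,G$ and $e,f,g$ are the coefficients of the first and second fundamental forms of $S$, the latter with respect to the future-directed unit normal $N$ (that is, $e=\langle N,X_{xx}\rangle$, $f=\langle N,X_{xy}\rangle$, $g=\langle N,X_{yy}\rangle$ for the above parametrization $X$). **Theorem.** Let $C\subset\mathbf E_1^3$ be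 a curve, not necessarily planar. If $S_1$ and $S_2$ are two compact spacelike graphs on $P$ (over possibly different domains) with the same constant mean curvature $H\in\mathbb R$ and the same boundary $\partial S_1=\partial S_2=C$, then $S_1=S_2$. -/

import Mathlib

open Set
open scoped ContDiff

noncomputable section

/-- The parameter plane `ℝ²`. -/
abbrev R2 : Type := EuclideanSpace ℝ (Fin 2)

/-- The real vector space `ℝ³` underlying Lorentz-Minkowski space `E₁³`.  The Euclidean structure of
the type is used for the topology and for differentiation only; the Lorentzian metric is
`lorentzInner`. -/
abbrev R3 : Type := EuclideanSpace ℝ (Fin 3)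

/-- The Lorentzian metric `⟨v, w⟩ = v₁ w₁ + v₂ w₂ - v₃ w₃`. -/
def lorentzInner (v w : R3) : ℝ := v 0 * w 0 + v 1 * w 1 - v 2 * w 2

/-- The Lorentzian modulus `|v| = √|⟨v, v⟩|`. -/
def lorentzNorm (v : R3) : ℝ := √|lorentzInner v v|

/-- The Lorentzian vector product: the vector with `⟨v × w, a⟩ = det (v, w, a)` for all `a`. -/
def lorentzCross (v w : R3) : R3 :=
  !₂[v 1 * w 2 - v 2 * w 1, v 2 * w 0 - v 0 * w 2, -(v 0 * w 1 - v 1 * w 0)]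

theorem lorentzInner_lorentzCross (v w a : R3) :
    lorentzInner (lorentzCross v w) a = Matrix.det !![v 0, v 1, v 2; w 0, w 1, w 2; a 0, a 1, a 2] := by
  simp [lorentzInner, lorentzCross, Matrix.det_fin_three]
  ring

/-- The partial derivative `∂X/∂xᵢ` of a map `X : ℝ² → ℝ³`. -/
def partialD (i : Fin 2) (X : R2 → R3) (p : R2) : R3 :=
  fderiv ℝ X p (EuclideanSpace.single i 1)

open Classical in
/-- The Gauss map of a spacelike parametrized surface `X`: the future-directed (third coordinate
positive) one of the two unit vectors `± (X_u × X_v) / |X_u × X_v|`. -/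
def gaussMap (X : R2 → R3) (p : R2) : R3 :=
  let n : R3 := lorentzCross (partialD 0 X p) (partialD 1 X p)
  (if 0 < n 2 then (1 : ℝ) else -1) • (lorentzNorm n)⁻¹ • n

/-- The mean curvature `H = -(1/2) (e G - 2 f F + g E) / (E G - F²)` of a spacelike parametrized
surface `X` with respect to its future-directed Gauss map, where `E, F, G` and `e, f, g` are the
coefficients of the first and of the second fundamental form. -/
def meanCurvature (X : R2 → R3) (p : R2) : ℝ :=
  let N : R3 := gaussMap X p
  let E : ℝ := lorentzInner (partialD 0 X p) (partialD 0 X p)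
  let F : ℝ := lorentzInner (partialD 0 X p) (partialD 1 X p)
  let G : ℝ := lorentzInner (partialD 1 X p) (partialD 1 X p)
  let e : ℝ := lorentzInner N (partialD 0 (partialD 0 X) p)
  let f : ℝ := lorentzInner N (partialD 0 (partialD 1 X) p)
  let g : ℝ := lorentzInner N (partialD 1 (partialD 1 X) p);
  -(1 / 2) * ((e * G - 2 * f * F + g * E) / (E * G - F ^ 2))

/-- A bounded domain (non-empty connected open set) of `ℝ²` with smooth boundary: near each of its
boundary points it is the sublevel set of a smooth function with non-vanishing differential. -/
structure IsSmoothBoundedDomain (Ω : Set R2) : Prop where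
  isOpen : IsOpen Ω
  isConnected : IsConnected Ω
  isBounded : Bornology.IsBounded Ω
  smooth_boundary : ∀ p ∈ frontier Ω, ∃ (U : Set R2) (φ : R2 → ℝ), IsOpen U ∧ p ∈ U ∧
    ContDiffOn ℝ ∞ φ U ∧ fderiv ℝ φ p ≠ 0 ∧ ∀ q ∈ U, (q ∈ Ω ↔ φ q < 0)

/-- A spacelike affine plane `o + <e₁, e₂>` of `E₁³`, given by a point `o` and a Lorentz-orthonormal
basis `e₁, e₂, e₃` of `E₁³` whose last vector is timelike, hence a unit normal of the plane.  The
horizontal plane `z = 0` is the one with `o = 0` and the usual basis. -/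
structure SpacelikePlane where
  o : R3
  e₁ : R3
  e₂ : R3
  e₃ : R3
  inner_e₁_e₁ : lorentzInner e₁ e₁ = 1
  inner_e₂_e₂ : lorentzInner e₂ e₂ = 1
  inner_e₃_e₃ : lorentzInner e₃ e₃ = -1
  inner_e₁_e₂ : lorentzInner e₁ e₂ = 0
  inner_e₁_e₃ : lorentzInner e₁ e₃ = 0
  inner_e₂_e₃ : lorentzInner e₂ e₃ = 0

/-- The parametrization `(x, y) ↦ o + x e₁ + y e₂ + u(x, y) e₃` of the graph of `u` on the plane `P`;
it is `(x, y) ↦ (x, y, u(x, y))` when `P` is the plane `z = 0`. -/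
def graphMap (P : SpacelikePlane) (u : R2 → ℝ) (q : R2) : R3 :=
  P.o + q 0 • P.e₁ + q 1 • P.e₂ + u q • P.e₃

/-- A compact spacelike graph on the spacelike plane `P`: the graph of a function `u` that is smooth
on the closure of a bounded domain with smooth boundary, all of whose tangent planes (at boundary
points too) are spacelike. -/
structure CompactSpacelikeGraph (P : SpacelikePlane) where
  domain : Set R2
  u : R2 → ℝ
  isSmoothBoundedDomain : IsSmoothBoundedDomain domain
  smooth : ContDiffOn ℝ ∞ u (closure domain)
  spacelike : ∀ q ∈ closure domain, ∀ v : R2, v ≠ 0 →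
    0 < lorentzInner (fderivWithin ℝ (graphMap P u) (closure domain) q v)
      (fderivWithin ℝ (graphMap P u) (closure domain) q v)

namespace CompactSpacelikeGraph

variable {P : SpacelikePlane}

/-- The graph, as a subset of `E₁³` (boundary included). -/
def carrier (S : CompactSpacelikeGraph P) : Set R3 := graphMap P S.u '' closure S.domain

/-- The boundary curve of the graph. -/
def boundary (S : CompactSpacelikeGraph P) : Set R3 := graphMap P S.u '' frontier S.domain

/-- The graph has constant mean curvature `H` (at its interior points, hence by continuity also along
its boundary). -/
def HasConstantMeanCurvature (S : CompactSpacelikeGraph P) (H : ℝ) : Prop :=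
  ∀ q ∈ S.domain, meanCurvature (graphMap P S.u) q = H

end CompactSpacelikeGraph

end

/-! Coordinates with respect to `e₁, e₂, e₃` are unique, so equal boundary curves mean equal
frontiers of the two domains and equal heights over them. Two facts then suffice.

Topology (`IsSmoothBoundedDomain.eq_of_frontier_eq`): bounded smooth domains with the same frontier
coincide. If they were disjoint, they would lie on opposite sides of every frontier point, and the
union of their closures would be open, closed and bounded. Smoothness matters: the lakes of Wada are
disjoint domains with a common frontier.

Analysis (`le_of_solvesMeanCurvatureEquation`): both heights solve the same quasilinear elliptic
equation, so a comparison principle applies in both directions. If `u₁ - u₂` were positive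
somewhere, `u₁ - u₂ + ε exp (α x)` with small `ε` would have an interior maximum. There the
gradients differ only by `c = ε α exp (α x)` in the `x` direction, so coefficients and right-hand
sides differ by `O(c)`, while the barrier contributes a second derivative `α c`. A large `α` is
contradictory (`barrier_algebra`). -/

/-! ### Smooth bounded domains are determined by their frontier -/

open Topology Filter in
-- The exterior of a smooth domain is locally connected to a single point: the defining function
-- increases along a fixed direction `v`, so exterior points near `p` can be pushed along `v` to a
-- neighbourhood of `z = p + s v` without leaving the exterior.
theorem IsSmoothBoundedDomain.exists_exterior_connection {Ω : Set R2}
    (h : IsSmoothBoundedDomain Ω) {p : R2} (hp : p ∈ frontier Ω) :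
    ∃ W ∈ 𝓝 p, ∃ z : R2, ∀ q ∈ W, q ∈ closure Ω ∨
      ∃ t : Set R2, IsPreconnected t ∧ q ∈ t ∧ z ∈ t ∧ Disjoint t (closure Ω) := by
  obtain ⟨U, φ, hU, hpU, hφ, hd, hΩ⟩ := h.smooth_boundary p hp
  obtain ⟨v, hv⟩ : ∃ v, 0 < fderiv ℝ φ p v := by
    obtain ⟨v, hv⟩ : ∃ v, fderiv ℝ φ p v ≠ 0 := by
      by_contra! hcon
      exact hd (ContinuousLinearMap.ext hcon)
    rcases lt_or_gt_of_ne hv with hv | hv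
    · exact ⟨-v, by simpa using hv⟩
    · exact ⟨v, hv⟩
  have hv0 : v ≠ 0 := by rintro rfl; simp at hv
  have hcd : ContinuousOn (fun q => fderiv ℝ φ q v) U :=
    (hφ.continuousOn_fderiv_of_isOpen hU (by simp)).clm_apply continuousOn_const
  obtain ⟨r, hr, hB⟩ : ∃ r > 0, Metric.ball p r ⊆ U ∩ {q | 0 < fderiv ℝ φ q v} := by
    refine Metric.mem_nhds_iff.1 (inter_mem (hU.mem_nhds hpU) ?_)
    exact (hcd.continuousAt (hU.mem_nhds hpU)).eventually (lt_mem_nhds hv)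
  have hdiff : ∀ q ∈ Metric.ball p r, HasFDerivAt φ (fderiv ℝ φ q) q := fun q hq =>
    ((hφ.differentiableOn (by simp)).differentiableAt (hU.mem_nhds (hB hq).1)).hasFDerivAt
  have hmono : ∀ q ∈ Metric.ball p r, ∀ s : ℝ, 0 < s → q + s • v ∈ Metric.ball p r →
      φ q < φ (q + s • v) := by
    intro q hq s hs hqs
    obtain ⟨z, hz, he⟩ := domain_mvt (fun x hx => (hdiff x hx).hasFDerivWithinAt)
      (convex_ball p r) hq hqs
    have hzB := (convex_ball p r).segment_subset hq hqs hz
    have : 0 < s * fderiv ℝ φ z v := mul_pos hs (hB hzB).2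
    simp at he
    linarith
  have hopen : IsOpen (U ∩ φ ⁻¹' Ioi 0) := hφ.continuousOn.isOpen_inter_preimage hU isOpen_Ioi
  have hext : Disjoint (U ∩ φ ⁻¹' Ioi 0) (closure Ω) := by
    refine Disjoint.closure_right ?_ hopen
    rw [Set.disjoint_left]
    rintro x ⟨hx, hx0⟩ hxΩ
    have := (hΩ x hx).1 hxΩ
    simp only [mem_preimage, mem_Ioi] at hx0
    linarith
  -- Moving backwards along `v` makes `φ` strictly negative, so the zero set lies in the closure
  -- too.
  have hint : ∀ q ∈ Metric.ball p r, φ q ≤ 0 → q ∈ closure Ω := by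
    intro q hq hq0
    have hc : Tendsto (fun s : ℝ => q - s • v) (𝓝[>] 0) (𝓝 q) := by
      have : Continuous (fun s : ℝ => q - s • v) := by fun_prop
      simpa using (this.tendsto 0).mono_left nhdsWithin_le_nhds
    refine mem_closure_of_tendsto hc ?_
    filter_upwards [hc (Metric.isOpen_ball.mem_nhds hq), self_mem_nhdsWithin] with s hs hs0
    have := hmono (q - s • v) hs s hs0 (by simpa using hq)
    rw [sub_add_cancel] at this
    exact (hΩ _ (hB hs).1).2 (this.trans_le hq0)
  have hp0 : 0 ≤ φ p := by
    by_contra! hcon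
    have := hp.2
    rw [h.isOpen.interior_eq] at this
    exact this ((hΩ p hpU).2 hcon)
  have hvn : 0 < ‖v‖ := norm_pos_iff.2 hv0
  -- The displacement `s v` has length `r / 4`, so the ball of radius `r / 2` stays in the ball of
  -- radius `r`.
  set s := r / 2 / (2 * ‖v‖) with hs
  have hs0 : 0 < s := by positivity
  have hsv : s * ‖v‖ < r / 2 := by
    rw [hs]; field_simp; norm_num
  have hmem : ∀ q ∈ Metric.ball p (r / 2), ∀ a : ℝ, 0 ≤ a → a ≤ s →
      q + a • v ∈ Metric.ball p r := by
    intro q hq a ha has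
    rw [mem_ball_iff_norm] at hq ⊢
    calc ‖q + a • v - p‖ = ‖(q - p) + a • v‖ := by congr 1; abel
      _ ≤ ‖q - p‖ + ‖a • v‖ := norm_add_le _ _
      _ = ‖q - p‖ + a * ‖v‖ := by rw [norm_smul, Real.norm_of_nonneg ha]
      _ < r := by nlinarith
  have hpB : p ∈ Metric.ball p (r / 2) := Metric.mem_ball_self (by positivity)
  have hzB := hmem p hpB s hs0.le le_rfl
  have hz0 : 0 < φ (p + s • v) :=
    hp0.trans_lt (hmono p (Metric.mem_ball_self hr) s hs0 hzB)
  obtain ⟨δ, hδ, hδB⟩ := Metric.mem_nhds_iff.1 (hopen.mem_nhds (x := p + s • v) ⟨(hB hzB).1, hz0⟩)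
  refine ⟨Metric.ball p (min δ (r / 2)), Metric.ball_mem_nhds _ (by positivity), p + s • v,
    fun q hq => ?_⟩
  have hq2 : q ∈ Metric.ball p (r / 2) := Metric.ball_subset_ball (min_le_right _ _) hq
  have hqB : q ∈ Metric.ball p r := Metric.ball_subset_ball (by linarith) hq2
  rcases le_or_gt (φ q) 0 with hq0 | hq0
  · exact Or.inl (hint q hqB hq0)
  right
  refine ⟨segment ℝ q (q + s • v) ∪ Metric.ball (p + s • v) δ, ?_, Or.inl (left_mem_segment _ _ _),
    Or.inr (Metric.mem_ball_self hδ), hext.mono_left (union_subset ?_ hδB)⟩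
  · refine IsPreconnected.union (q + s • v) (right_mem_segment _ _ _) ?_
      (convex_segment _ _).isPreconnected (convex_ball _ _).isPreconnected
    have : q ∈ Metric.ball p δ := Metric.ball_subset_ball (min_le_left _ _) hq
    simpa [Metric.mem_ball] using this
  · rw [segment_eq_image']
    rintro _ ⟨θ, hθ, rfl⟩
    simp only [add_sub_cancel_left, smul_smul]
    rcases hθ.1.eq_or_lt with h0 | h0
    · rw [← h0]
      simpa using ⟨(hB hqB).1, hq0⟩
    · have := hmem q hq2 (θ * s) (by positivity) (by nlinarith [hθ.2])
      exact ⟨(hB this).1, hq0.trans (hmono q hqB _ (by positivity) this)⟩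

theorem IsPreconnected.subset_of_disjoint_frontier {X : Type*} [TopologicalSpace X] {t s : Set X}
    (ht : IsPreconnected t) (hs : IsOpen s) (hts : (t ∩ s).Nonempty)
    (hd : Disjoint t (frontier s)) : t ⊆ s := by
  refine ht.subset_left_of_subset_union hs isClosed_closure.isOpen_compl
    (disjoint_compl_right.mono_left subset_closure) (fun x hx => ?_) hts
  by_contra hcon
  rw [mem_union, mem_compl_iff, not_or, not_not, closure_eq_self_union_frontier] at hcon
  exact Set.disjoint_left.1 hd hx (hcon.2.resolve_left hcon.1)

theorem IsSmoothBoundedDomain.disjoint_frontier {Ω : Set R2} (h : IsSmoothBoundedDomain Ω) :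
    Disjoint Ω (frontier Ω) := by
  rw [h.isOpen.frontier_eq]
  exact disjoint_sdiff_self_right

theorem IsSmoothBoundedDomain.eq_of_frontier_eq {Ω₁ Ω₂ : Set R2} (h₁ : IsSmoothBoundedDomain Ω₁)
    (h₂ : IsSmoothBoundedDomain Ω₂) (h : frontier Ω₁ = frontier Ω₂) : Ω₁ = Ω₂ := by
  by_cases hne : (Ω₁ ∩ Ω₂).Nonempty
  · exact (h₁.isConnected.isPreconnected.subset_of_disjoint_frontier h₂.isOpen hne
      (h ▸ h₁.disjoint_frontier)).antisymm
      (h₂.isConnected.isPreconnected.subset_of_disjoint_frontier h₁.isOpen (by rwa [inter_comm])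
      (h ▸ h₂.disjoint_frontier))
  exfalso
  have hdisj : Disjoint (closure Ω₁) Ω₂ := by
    refine Disjoint.closure_left ?_ h₂.isOpen
    rwa [Set.disjoint_iff_inter_eq_empty, ← Set.not_nonempty_iff_eq_empty]
  -- At a frontier point, `Ω₂` meets the exterior of `Ω₁`. That exterior is locally connected
  -- through `z` away from the common frontier, so all of it near the point belongs to `Ω₂`.
  have hopen : IsOpen (closure Ω₁ ∪ closure Ω₂) := by
    rw [isOpen_iff_mem_nhds]
    intro p hp
    by_cases hpf : p ∈ frontier Ω₁
    · obtain ⟨W, hW, z, hWz⟩ := h₁.exists_exterior_connection hpf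
      have key : ∀ q ∈ W, q ∉ closure Ω₁ → (q ∈ Ω₂ ↔ z ∈ Ω₂) := by
        intro q hq hq1
        obtain ⟨t, ht, hqt, hzt, hdt⟩ := (hWz q hq).resolve_left hq1
        have hdf : Disjoint t (frontier Ω₂) := h ▸ hdt.mono_right frontier_subset_closure
        exact ⟨fun hq2 => ht.subset_of_disjoint_frontier h₂.isOpen ⟨q, hqt, hq2⟩ hdf hzt,
          fun hz2 => ht.subset_of_disjoint_frontier h₂.isOpen ⟨z, hzt, hz2⟩ hdf hqt⟩
      obtain ⟨q, hqW, hq2⟩ := mem_closure_iff_nhds.1 (frontier_subset_closure (h ▸ hpf)) W hW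
      have hz := (key q hqW (Set.disjoint_right.1 hdisj hq2)).1 hq2
      filter_upwards [hW] with x hx
      by_cases hx1 : x ∈ closure Ω₁
      · exact Or.inl hx1
      · exact Or.inr (subset_closure ((key x hx hx1).2 hz))
    · have hp' : p ∈ Ω₁ ∪ Ω₂ := by
        rw [closure_eq_self_union_frontier, closure_eq_self_union_frontier, ← h] at hp
        rcases hp with (hp | hp) | (hp | hp)
        · exact Or.inl hp
        · exact absurd hp hpf
        · exact Or.inr hp
        · exact absurd hp hpf
      exact Filter.mem_of_superset ((h₁.isOpen.union h₂.isOpen).mem_nhds hp')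
        (union_subset_union subset_closure subset_closure)
  have huniv : closure Ω₁ ∪ closure Ω₂ = univ :=
    IsClopen.eq_univ ⟨isClosed_closure.union isClosed_closure, hopen⟩
      (h₁.isConnected.nonempty.closure.mono subset_union_left)
  have hb := h₁.isBounded.closure.union h₂.isBounded.closure
  rw [huniv] at hb
  exact NormedSpace.unbounded_univ ℝ R2 hb

/-! ### Comparison principle for the mean curvature equation -/

open Topology in
theorem IsLocalMax.fderiv_fderiv_apply_nonpos {E : Type*} [NormedAddCommGroup E] [NormedSpace ℝ E]
    {f : E → ℝ} {x : E} (h : IsLocalMax f x) (hf : ContDiffAt ℝ 2 f x) (v : E) :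
    fderiv ℝ (fderiv ℝ f) x v v ≤ 0 := by
  by_contra! hpos
  have hline : ∀ t : ℝ, HasDerivAt (fun t : ℝ => x + t • v) v t := fun t => by
    simpa using ((hasDerivAt_id t).smul_const v).const_add x
  have hcont : Filter.Tendsto (fun t : ℝ => x + t • v) (𝓝 0) (𝓝 x) := by
    simpa using (hline 0).continuousAt.tendsto
  have hx : x + (0 : ℝ) • v = x := by simp
  have hd1 : deriv (fun t : ℝ => f (x + t • v)) =ᶠ[𝓝 0] fun t => fderiv ℝ f (x + t • v) v := by
    filter_upwards [hcont.eventually (hf.eventually (by simp))] with t ht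
    exact ((ht.differentiableAt (by simp)).hasFDerivAt.comp_hasDerivAt t (hline t)).deriv
  have hd2 : deriv (deriv fun t : ℝ => f (x + t • v)) 0 = fderiv ℝ (fderiv ℝ f) x v v := by
    rw [hd1.deriv_eq]
    have hff : HasFDerivAt (fderiv ℝ f) (fderiv ℝ (fderiv ℝ f) x) x :=
      ((hf.fderiv_right (m := 1) (by norm_num)).differentiableAt (by simp)).hasFDerivAt
    have hfv : HasFDerivAt (fun y => fderiv ℝ f y v) ((fderiv ℝ (fderiv ℝ f) x).flip v)
        (x + (0 : ℝ) • v) := by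
      rw [hx]
      simpa using hff.clm_apply (hasFDerivAt_const v x)
    exact (hfv.comp_hasDerivAt (0 : ℝ) (hline 0)).deriv
  have hmax : IsLocalMax (fun t : ℝ => f (x + t • v)) 0 := by
    filter_upwards [hcont.eventually h] with t ht
    simpa using ht
  have hcontf : ContinuousAt (fun t : ℝ => f (x + t • v)) 0 :=
    ContinuousAt.comp (by rw [hx]; exact hf.continuousAt) (hline 0).continuousAt
  -- A positive second derivative makes the maximum also a minimum along the line; the restriction
  -- is then locally constant, with zero second derivative.
  have hmin := isLocalMin_of_deriv_deriv_pos (by rwa [hd2]) hmax.deriv_eq_zero hcontf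
  have hconst : (fun t : ℝ => f (x + t • v)) =ᶠ[𝓝 0] fun _ => f x := by
    filter_upwards [hmax, hmin] with t h1 h2
    simpa using le_antisymm h1 h2
  rw [hconst.deriv.deriv_eq] at hd2
  simp at hd2
  linarith

/-- Algebraic core of the comparison principle: first derivatives `(s, t)`, `(s + c, t)` and Hessians
`a`, `b` at a maximum of the difference perturbed by an exponential barrier. -/
theorem barrier_algebra {s t c α k K l a₀ a₁ a₂ b₀ b₁ b₂ : ℝ} (hc : 0 < c)
    (h₁ : 0 < 1 - s ^ 2 - t ^ 2) (h₂ : 0 < 1 - (s + c) ^ 2 - t ^ 2)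
    (hl : l ≤ 1 - s ^ 2 - t ^ 2) (hα : 4 * K + 4 * |k| < α * l) (hα0 : 0 ≤ α)
    (hb₁ : |b₁| ≤ K) (hb₂ : |b₂| ≤ K)
    (ha : (1 - t ^ 2) * a₀ + 2 * s * t * a₁ + (1 - s ^ 2) * a₂ = k * √(1 - s ^ 2 - t ^ 2) ^ 3)
    (hb : (1 - t ^ 2) * b₀ + 2 * (s + c) * t * b₁ + (1 - (s + c) ^ 2) * b₂ =
      k * √(1 - (s + c) ^ 2 - t ^ 2) ^ 3)
    (hM₀ : a₀ - b₀ + α * c ≤ 0) (hM₂ : a₂ - b₂ ≤ 0)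
    (hM : s ^ 2 * (a₀ - b₀ + α * c) + 2 * s * t * (a₁ - b₁) + t ^ 2 * (a₂ - b₂) ≤ 0) : False := by
  set A := √(1 - s ^ 2 - t ^ 2) with hA
  set B := √(1 - (s + c) ^ 2 - t ^ 2) with hB
  have hA0 : 0 < A := Real.sqrt_pos.2 h₁
  have hB0 : 0 < B := Real.sqrt_pos.2 h₂
  have hA2 : A ^ 2 = 1 - s ^ 2 - t ^ 2 := Real.sq_sqrt h₁.le
  have hB2 : B ^ 2 = 1 - (s + c) ^ 2 - t ^ 2 := Real.sq_sqrt h₂.le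
  have hA1 : A ≤ 1 := by nlinarith [sq_nonneg s, sq_nonneg t]
  have hB1 : B ≤ 1 := by nlinarith [sq_nonneg (s + c), sq_nonneg t]
  have hs : |s| ≤ 1 := abs_le_one_iff_mul_self_le_one.2 (by nlinarith [sq_nonneg t])
  have hs' : |s + c| ≤ 1 := abs_le_one_iff_mul_self_le_one.2 (by nlinarith [sq_nonneg t])
  have ht : |t| ≤ 1 := abs_le_one_iff_mul_self_le_one.2 (by nlinarith [sq_nonneg s])
  have hss : |s + (s + c)| ≤ 2 := (abs_add_le _ _).trans (by linarith)
  have hD : (1 - s ^ 2 - t ^ 2) * (a₀ - b₀ + α * c + (a₂ - b₂)) ≤ 0 :=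
    mul_nonpos_of_nonneg_of_nonpos h₁.le (by linarith)
  -- Multiplying by `A + B` turns the difference of cubes into one of squares, so no positive lower
  -- bound on `A` or `B` is needed.
  have hcube : |A ^ 3 - B ^ 3| ≤ 4 * c := by
    have e : (A ^ 3 - B ^ 3) * (A + B) = c * (s + (s + c)) * (A ^ 2 + A * B + B ^ 2) := by
      linear_combination (A ^ 2 + A * B + B ^ 2) * (hA2 - hB2)
    have e' : |A ^ 3 - B ^ 3| * (A + B) = c * |s + (s + c)| * (A ^ 2 + A * B + B ^ 2) := by
      have := congrArg abs e
      rwa [abs_mul, abs_mul, abs_mul, abs_of_pos (add_pos hA0 hB0), abs_of_pos hc,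
        abs_of_pos (by positivity : 0 < A ^ 2 + A * B + B ^ 2)] at this
    have q : A ^ 2 + A * B + B ^ 2 ≤ 2 * (A + B) := by
      linarith [mul_nonneg hA0.le (sub_nonneg.2 hA1), mul_nonneg hB0.le (sub_nonneg.2 hB1),
        mul_nonneg hA0.le (sub_nonneg.2 hB1)]
    have r : |A ^ 3 - B ^ 3| * (A + B) ≤ 4 * c * (A + B) := by
      rw [e']
      calc c * |s + (s + c)| * (A ^ 2 + A * B + B ^ 2) ≤ c * 2 * (2 * (A + B)) := by gcongr
        _ = 4 * c * (A + B) := by ring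
    exact le_of_mul_le_mul_right r (add_pos hA0 hB0)
  have hk : |k * (A ^ 3 - B ^ 3)| ≤ |k| * (4 * c) := by
    rw [abs_mul]; gcongr
  have h1 : |t * b₁| ≤ 1 * K := by rw [abs_mul]; gcongr
  have h2 : |(s + (s + c)) * b₂| ≤ 2 * K := by rw [abs_mul]; gcongr
  have hmain : (1 - t ^ 2) * (α * c) ≤
      c * (-2 * (t * b₁) + (s + (s + c)) * b₂) - k * (A ^ 3 - B ^ 3) := by
    -- The coefficient matrix is `(1 - s² - t²) I + (s, t)ᵀ (s, t)`, so its pairing with the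
    -- perturbed Hessian is a trace term plus the quadratic form at `(s, t)`, both nonpositive.
    have : (1 - t ^ 2) * (α * c) -
        (c * (-2 * (t * b₁) + (s + (s + c)) * b₂) - k * (A ^ 3 - B ^ 3)) =
        (1 - s ^ 2 - t ^ 2) * (a₀ - b₀ + α * c + (a₂ - b₂)) +
        (s ^ 2 * (a₀ - b₀ + α * c) + 2 * s * t * (a₁ - b₁) + t ^ 2 * (a₂ - b₂)) := by
      linear_combination hb - ha
    linarith only [this, hD, hM]
  clear ha hb hM hD hcube
  have hlow : l * (α * c) ≤ (1 - t ^ 2) * (α * c) := by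
    gcongr; nlinarith [sq_nonneg s]
  have hup : c * (-2 * (t * b₁) + (s + (s + c)) * b₂) ≤ c * (4 * K) := by
    gcongr
    linarith [(abs_le.1 h1).1, (abs_le.1 h2).2]
  have := mul_lt_mul_of_pos_left hα hc
  linarith [(abs_le.1 hk).1]

/-- The equation `(1 - u_y²) u_xx + 2 u_x u_y u_xy + (1 - u_x²) u_yy = k (1 - |Du|²)^{3/2}` at `q`,
together with the spacelike condition `|Du| < 1`. -/
def SolvesMeanCurvatureEquation (u : R2 → ℝ) (k : ℝ) (q : R2) : Prop :=
  let e (i : Fin 2) : R2 := EuclideanSpace.single i 1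
  let s := fderiv ℝ u q (e 0)
  let t := fderiv ℝ u q (e 1)
  let B := fderiv ℝ (fderiv ℝ u) q
  0 < 1 - s ^ 2 - t ^ 2 ∧
  (1 - t ^ 2) * B (e 0) (e 0) + 2 * s * t * B (e 0) (e 1) + (1 - s ^ 2) * B (e 1) (e 1) =
    k * √(1 - s ^ 2 - t ^ 2) ^ 3

theorem hasFDerivAt_exp_coord (α : ℝ) (i : Fin 2) (q : R2) :
    HasFDerivAt (fun q : R2 => Real.exp (α * q i))
      ((α * Real.exp (α * q i)) • (EuclideanSpace.proj i : StrongDual ℝ R2)) q := by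
  have h : HasFDerivAt (fun q : R2 => q i)
    (EuclideanSpace.proj i : StrongDual ℝ R2) q :=
    (EuclideanSpace.proj i : StrongDual ℝ R2).hasFDerivAt
  refine (h.const_mul α).exp.congr_fderiv ?_
  rw [smul_smul, mul_comm]

theorem fderiv_fderiv_exp_coord (α : ℝ) (i : Fin 2) (q v w : R2) :
    fderiv ℝ (fderiv ℝ fun q : R2 => Real.exp (α * q i)) q v w =
      α ^ 2 * Real.exp (α * q i) * v i * w i := by
  have h : fderiv ℝ (fun q : R2 => Real.exp (α * q i)) = fun q =>
      (α * Real.exp (α * q i)) • (EuclideanSpace.proj i : StrongDual ℝ R2) :=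
    funext fun q => (hasFDerivAt_exp_coord α i q).fderiv
  have h' := ((hasFDerivAt_exp_coord α i q).const_mul α).smul_const
    (EuclideanSpace.proj i : StrongDual ℝ R2)
  rw [h, h'.fderiv]
  simp [-mul_eq_mul_right_iff, -mul_eq_mul_left_iff]
  ring

theorem not_isLocalMax_sub_add_exp {u₁ u₂ : R2 → ℝ} {k K l α ε : ℝ} {q : R2}
    (hu₁ : ContDiffAt ℝ 2 u₁ q) (hu₂ : ContDiffAt ℝ 2 u₂ q)
    (h₁ : SolvesMeanCurvatureEquation u₁ k q) (h₂ : SolvesMeanCurvatureEquation u₂ k q)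
    (hl : l ≤ 1 - fderiv ℝ u₁ q (EuclideanSpace.single 0 1) ^ 2 -
      fderiv ℝ u₁ q (EuclideanSpace.single 1 1) ^ 2)
    (hK : ‖fderiv ℝ (fderiv ℝ u₂) q‖ ≤ K) (hα0 : 0 < α) (hε : 0 < ε)
    (hα : 4 * K + 4 * |k| < α * l) :
    ¬ IsLocalMax (fun q => u₁ q - u₂ q + ε * Real.exp (α * q 0)) q := by
  intro hmax
  have hE : ContDiff ℝ 2 (fun q : R2 => Real.exp (α * q 0)) := by fun_prop
  have hf : ContDiffAt ℝ 2 (fun q => u₁ q - u₂ q + ε * Real.exp (α * q 0)) q :=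
    (hu₁.sub hu₂).add (contDiffAt_const.mul hE.contDiffAt)
  have hfd : ∀ x, ContDiffAt ℝ 2 u₁ x → ContDiffAt ℝ 2 u₂ x →
      fderiv ℝ (fun q => u₁ q - u₂ q + ε * Real.exp (α * q 0)) x =
      fderiv ℝ u₁ x - fderiv ℝ u₂ x + ε • fderiv ℝ (fun q => Real.exp (α * q 0)) x := by
    intro x h1 h2
    exact (((h1.differentiableAt (by simp)).hasFDerivAt.sub
      (h2.differentiableAt (by simp)).hasFDerivAt).add
      ((hE.differentiable (by simp) x).hasFDerivAt.const_mul ε)).fderiv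
  have hdd : ∀ {u : R2 → ℝ}, ContDiffAt ℝ 2 u q →
      HasFDerivAt (fderiv ℝ u) (fderiv ℝ (fderiv ℝ u) q) q := fun hu =>
    ((hu.fderiv_right (m := 1) (by norm_num)).differentiableAt (by simp)).hasFDerivAt
  have hfdd : fderiv ℝ (fderiv ℝ (fun q => u₁ q - u₂ q + ε * Real.exp (α * q 0))) q =
      fderiv ℝ (fderiv ℝ u₁) q - fderiv ℝ (fderiv ℝ u₂) q +
        ε • fderiv ℝ (fderiv ℝ fun q => Real.exp (α * q 0)) q := by
    rw [Filter.EventuallyEq.fderiv_eq (f₁ := fderiv ℝ _) (f := fun x => fderiv ℝ u₁ x -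
      fderiv ℝ u₂ x + ε • fderiv ℝ (fun q => Real.exp (α * q 0)) x)]
    · exact (((hdd hu₁).sub (hdd hu₂)).add ((hdd hE.contDiffAt).const_smul ε)).fderiv
    · filter_upwards [hu₁.eventually (by simp), hu₂.eventually (by simp)] with x h1 h2
      exact hfd x h1 h2
  have hgrad : ∀ v : R2, fderiv ℝ u₁ q v - fderiv ℝ u₂ q v +
      ε * (α * Real.exp (α * q 0) * v 0) = 0 := by
    intro v
    have := hmax.fderiv_eq_zero
    rw [hfd q hu₁ hu₂, (hasFDerivAt_exp_coord α 0 q).fderiv] at this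
    simpa using congrArg (fun L : R2 →L[ℝ] ℝ => L v) this
  have hhess : ∀ v : R2, fderiv ℝ (fderiv ℝ u₁) q v v - fderiv ℝ (fderiv ℝ u₂) q v v +
      ε * (α ^ 2 * Real.exp (α * q 0) * v 0 * v 0) ≤ 0 := by
    intro v
    have := hmax.fderiv_fderiv_apply_nonpos hf v
    rw [hfdd] at this
    simpa [fderiv_fderiv_exp_coord] using this
  have hKb : ∀ i j : Fin 2, |fderiv ℝ (fderiv ℝ u₂) q (EuclideanSpace.single i 1)
      (EuclideanSpace.single j 1)| ≤ K := fun i j => by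
    refine le_trans ?_ hK
    simpa using (fderiv ℝ (fderiv ℝ u₂) q).le_opNorm₂ (EuclideanSpace.single i (1 : ℝ))
      (EuclideanSpace.single j (1 : ℝ))
  have hsym : ∀ {u : R2 → ℝ}, ContDiffAt ℝ 2 u q → ∀ v w,
      fderiv ℝ (fderiv ℝ u) q v w = fderiv ℝ (fderiv ℝ u) q w v := fun hu v w =>
    hu.isSymmSndFDerivAt (by simp) v w
  obtain ⟨h₁p, h₁e⟩ := h₁
  obtain ⟨h₂p, h₂e⟩ := h₂
  have g0 := hgrad (EuclideanSpace.single 0 1)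
  have g1 := hgrad (EuclideanSpace.single 1 1)
  have H0 := hhess (EuclideanSpace.single 0 1)
  have H1 := hhess (EuclideanSpace.single 1 1)
  -- The gradient of `u₁` is the direction of the rank-one part of the coefficient matrix.
  have Hst := hhess (fderiv ℝ u₁ q (EuclideanSpace.single 0 1) • EuclideanSpace.single 0 1 +
    fderiv ℝ u₁ q (EuclideanSpace.single 1 1) • EuclideanSpace.single 1 1)
  simp only [map_add, map_smul, add_apply, smul_apply,
    smul_eq_mul, PiLp.add_apply, PiLp.smul_apply] at Hst
  rw [hsym hu₁ (EuclideanSpace.single 1 1) (EuclideanSpace.single 0 1),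
    hsym hu₂ (EuclideanSpace.single 1 1) (EuclideanSpace.single 0 1)] at Hst
  simp at g0 g1 H0 H1 Hst
  set c := ε * (α * Real.exp (α * q 0)) with hc
  have e0 : fderiv ℝ u₂ q (EuclideanSpace.single 0 1) =
    fderiv ℝ u₁ q (EuclideanSpace.single 0 1) + c := by linarith
  have e1 : fderiv ℝ u₂ q (EuclideanSpace.single 1 1) =
    fderiv ℝ u₁ q (EuclideanSpace.single 1 1) := by linarith
  rw [e0, e1] at h₂p h₂e
  refine barrier_algebra (by positivity) h₁p h₂p hl hα hα0.le (hKb 0 1) (hKb 1 1) h₁e h₂e ?_ ?_ ?_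
  · rw [hc]; linarith
  · linarith
  · rw [hc]; linarith

theorem le_of_solvesMeanCurvatureEquation {Ω : Set R2} {u₁ u₂ : R2 → ℝ} {k : ℝ} (hΩ : IsOpen Ω)
    (hb : Bornology.IsBounded Ω) (hu₁ : ContDiffOn ℝ 2 u₁ Ω) (hu₂ : ContDiffOn ℝ 2 u₂ Ω)
    (hc₁ : ContinuousOn u₁ (closure Ω)) (hc₂ : ContinuousOn u₂ (closure Ω))
    (h₁ : ∀ q ∈ Ω, SolvesMeanCurvatureEquation u₁ k q)
    (h₂ : ∀ q ∈ Ω, SolvesMeanCurvatureEquation u₂ k q)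
    (hle : ∀ q ∈ frontier Ω, u₁ q ≤ u₂ q) : ∀ q ∈ closure Ω, u₁ q ≤ u₂ q := by
  intro q₀ hq₀
  by_contra! hlt
  set M := u₁ q₀ - u₂ q₀ with hM
  have hM0 : 0 < M := by linarith
  have hcomp : IsCompact (closure Ω) := hb.isCompact_closure
  have hcw : ContinuousOn (fun q => u₁ q - u₂ q) (closure Ω) := hc₁.sub hc₂
  -- All bounds are taken on this compact subset of the open set `Ω`, so no control of derivatives
  -- up to the frontier is needed.
  set T := closure Ω ∩ (fun q => u₁ q - u₂ q) ⁻¹' Ici (M / 2) with hT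
  have hTc : IsCompact T :=
    hcomp.of_isClosed_subset (hcw.preimage_isClosed_of_isClosed isClosed_closure isClosed_Ici)
      inter_subset_left
  have hTΩ : T ⊆ Ω := by
    rintro q ⟨hq, hq'⟩
    rw [closure_eq_self_union_frontier] at hq
    rcases hq with hq | hq
    · exact hq
    · have := hle q hq
      simp only [mem_preimage, mem_Ici] at hq'
      linarith
  have hq₀T : q₀ ∈ T := ⟨hq₀, by simp only [mem_preimage, mem_Ici]; linarith⟩
  have hd : ContinuousOn (fderiv ℝ u₁) Ω := hu₁.continuousOn_fderiv_of_isOpen hΩ (by simp)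
  have hgrad : ContinuousOn (fun q => 1 - fderiv ℝ u₁ q (EuclideanSpace.single 0 1) ^ 2 -
      fderiv ℝ u₁ q (EuclideanSpace.single 1 1) ^ 2) T :=
    ((continuousOn_const.sub ((hd.clm_apply continuousOn_const).pow 2)).sub
      ((hd.clm_apply continuousOn_const).pow 2)).mono hTΩ
  obtain ⟨q₁, hq₁, hmin⟩ := hTc.exists_isMinOn ⟨q₀, hq₀T⟩ hgrad
  set l := 1 - fderiv ℝ u₁ q₁ (EuclideanSpace.single 0 1) ^ 2 -
      fderiv ℝ u₁ q₁ (EuclideanSpace.single 1 1) ^ 2 with hl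
  have hl0 : 0 < l := (h₁ q₁ (hTΩ hq₁)).1
  obtain ⟨K, hK⟩ := hTc.exists_bound_of_continuousOn
    (((hu₂.fderiv_of_isOpen (m := 1) hΩ (by norm_num)).continuousOn_fderiv_of_isOpen hΩ
      (by simp)).mono hTΩ)
  have hK0 : 0 ≤ K := (norm_nonneg _).trans (hK q₀ hq₀T)
  set α := (4 * K + 4 * |k| + 1) / l with hα
  have hα0 : 0 < α := by positivity
  have hαl : 4 * K + 4 * |k| < α * l := by
    rw [hα, div_mul_cancel₀ _ hl0.ne']; linarith
  have hE : Continuous (fun q : R2 => Real.exp (α * q 0)) := by fun_prop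
  obtain ⟨R, hR⟩ := hcomp.exists_bound_of_continuousOn hE.continuousOn
  have hR0 : 0 ≤ R := (norm_nonneg _).trans (hR q₀ hq₀)
  -- The barrier stays below `M / 2` on the closure, which forces the perturbed maximum into `T`.
  set ε := M / 2 / (R + 1) with hε
  have hε0 : 0 < ε := by positivity
  have hεR : ∀ q ∈ closure Ω, ε * Real.exp (α * q 0) < M / 2 := by
    intro q hq
    have h1 : Real.exp (α * q 0) < R + 1 := by
      have := (Real.le_norm_self _).trans (hR q hq)
      linarith
    calc ε * Real.exp (α * q 0) < ε * (R + 1) := by gcongr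
      _ = M / 2 := by rw [hε]; field_simp
  obtain ⟨q, hq, hmax⟩ := hcomp.exists_isMaxOn ⟨q₀, hq₀⟩
    (hcw.add (continuousOn_const.mul hE.continuousOn) :
      ContinuousOn (fun q => u₁ q - u₂ q + ε * Real.exp (α * q 0)) (closure Ω))
  have hqT : q ∈ T := by
    refine ⟨hq, ?_⟩
    have h1 : u₁ q₀ - u₂ q₀ + ε * Real.exp (α * q₀ 0) ≤ u₁ q - u₂ q + ε * Real.exp (α * q 0) :=
      hmax hq₀
    have h2 := hεR q hq
    have h3 : 0 < ε * Real.exp (α * q₀ 0) := by positivity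
    simp only [mem_preimage, mem_Ici]
    linarith
  have hnhds := hΩ.mem_nhds (hTΩ hqT)
  exact not_isLocalMax_sub_add_exp (hu₁.contDiffAt hnhds) (hu₂.contDiffAt hnhds)
    (h₁ q (hTΩ hqT)) (h₂ q (hTΩ hqT)) (hmin hqT) (hK q hqT) hα0 hε0 hαl
    (hmax.isLocalMax (Filter.mem_of_superset hnhds subset_closure))

/-! ### Lorentzian algebra -/

theorem lorentzInner_add_left (a b c : R3) :
    lorentzInner (a + b) c = lorentzInner a c + lorentzInner b c := by
  simp [lorentzInner]; ring

theorem lorentzInner_smul_left (r : ℝ) (a b : R3) :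
    lorentzInner (r • a) b = r * lorentzInner a b := by
  simp [lorentzInner]; ring

theorem lorentzInner_comm (a b : R3) : lorentzInner a b = lorentzInner b a := by
  simp [lorentzInner]; ring

theorem lorentzInner_add_right (a b c : R3) :
    lorentzInner a (b + c) = lorentzInner a b + lorentzInner a c := by
  simp [lorentzInner]; ring

theorem lorentzInner_smul_right (r : ℝ) (a b : R3) :
    lorentzInner a (r • b) = r * lorentzInner a b := by
  simp [lorentzInner]; ring

theorem lorentzInner_lorentzCross_self (v w : R3) :
    lorentzInner (lorentzCross v w) (lorentzCross v w) =
      -(lorentzInner v v * lorentzInner w w - lorentzInner v w ^ 2) := by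
  simp [lorentzInner, lorentzCross]; ring

/-- The left side is `det (a, b, c)²`; it is minus the Gram determinant because the metric has
determinant `-1`. -/
theorem lorentzInner_lorentzCross_sq (a b c : R3) :
    lorentzInner (lorentzCross a b) c ^ 2 =
      -(lorentzInner a a * (lorentzInner b b * lorentzInner c c - lorentzInner b c ^ 2)
        - lorentzInner a b * (lorentzInner a b * lorentzInner c c - lorentzInner b c * lorentzInner a c)
        + lorentzInner a c * (lorentzInner a b * lorentzInner b c -
          lorentzInner b b * lorentzInner a c)) := by
  simp [lorentzInner, lorentzCross]; ring

theorem lorentzInner_lorentzCross_add_smul (a b c : R3) (s t : ℝ) :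
    lorentzInner (lorentzCross (a + s • c) (b + t • c)) c = lorentzInner (lorentzCross a b) c := by
  simp [lorentzInner, lorentzCross]; ring

/-- Timelike vectors `a`, `b` in the same time cone have negative product. -/
theorem lorentzInner_neg_of_timelike {a b : R3} (ha : lorentzInner a a < 0)
    (hb : lorentzInner b b < 0) (h : 0 < a 2 * b 2) : lorentzInner a b < 0 := by
  simp only [lorentzInner] at *
  have h1 : (a 0 * b 0 + a 1 * b 1) ^ 2 < (a 2 * b 2) ^ 2 := by
    calc (a 0 * b 0 + a 1 * b 1) ^ 2 ≤ (a 0 ^ 2 + a 1 ^ 2) * (b 0 ^ 2 + b 1 ^ 2) := by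
          nlinarith [sq_nonneg (a 0 * b 1 - a 1 * b 0)]
      _ < a 2 ^ 2 * b 2 ^ 2 := by
          apply mul_lt_mul'' <;> first | positivity | linarith
      _ = (a 2 * b 2) ^ 2 := by ring
  linarith [lt_of_pow_lt_pow_left₀ 2 h.le h1]

theorem lorentz_apply_two_ne_zero {a : R3} (ha : lorentzInner a a < 0) : a 2 ≠ 0 := by
  intro h
  simp only [lorentzInner, h] at ha
  nlinarith [sq_nonneg (a 0), sq_nonneg (a 1)]

/-! ### The mean curvature equation of a graph -/

namespace SpacelikePlane

variable (P : SpacelikePlane)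

/-- The Lorentz product of the future-directed unit normals of `P` with `e₃`: `-1` if `e₃` is
future-directed, and `1` otherwise. -/
noncomputable def timeSign : ℝ := if 0 < P.e₃ 2 then -1 else 1

theorem timeSign_sq : P.timeSign ^ 2 = 1 := by
  unfold timeSign; split_ifs <;> norm_num

/-- The time orientation chosen in the Gauss map makes this sign depend on `P` alone, so two graphs
on `P` with equal `H` satisfy the same equation. -/
theorem sign_mul_lorentzInner {n : R3} (hn : lorentzInner n n < 0)
    (h : lorentzInner n P.e₃ ^ 2 = 1) :
    (if 0 < n 2 then (1 : ℝ) else -1) * lorentzInner n P.e₃ = P.timeSign := by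
  have he : lorentzInner P.e₃ P.e₃ < 0 := by rw [P.inner_e₃_e₃]; norm_num
  have hn2 := lorentz_apply_two_ne_zero hn
  have he2 := lorentz_apply_two_ne_zero he
  have hneg : lorentzInner (-n) P.e₃ = - lorentzInner n P.e₃ := by simp [lorentzInner]; ring
  have hnn : lorentzInner (-n) (-n) < 0 := by simpa [lorentzInner] using hn
  have hsame : 0 < n 2 * P.e₃ 2 → lorentzInner n P.e₃ = -1 := fun hp => by
    have := lorentzInner_neg_of_timelike hn he hp
    rcases (by simpa using h : lorentzInner n P.e₃ = 1 ∨ lorentzInner n P.e₃ = -1)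
      with h1 | h1 <;> linarith
  have hopp : n 2 * P.e₃ 2 < 0 → lorentzInner n P.e₃ = 1 := fun hp => by
    have := lorentzInner_neg_of_timelike hnn he (by simpa using hp)
    rcases (by simpa using h : lorentzInner n P.e₃ = 1 ∨ lorentzInner n P.e₃ = -1)
      with h1 | h1 <;> linarith
  unfold timeSign
  rcases lt_or_gt_of_ne hn2 with h1 | h1 <;> rcases lt_or_gt_of_ne he2 with h2 | h2
  · rw [if_neg h1.not_gt, if_neg h2.not_gt, hsame (mul_pos_of_neg_of_neg h1 h2)]; norm_num
  · rw [if_neg h1.not_gt, if_pos h2, hopp (mul_neg_of_neg_of_pos h1 h2)]; norm_num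
  · rw [if_pos h1, if_neg h2.not_gt, hopp (mul_neg_of_pos_of_neg h1 h2)]; norm_num
  · rw [if_pos h1, if_pos h2, hsame (mul_pos h1 h2)]; norm_num

theorem lorentzInner_lorentzCross_e₃_sq (s t : ℝ) :
    lorentzInner (lorentzCross (P.e₁ + s • P.e₃) (P.e₂ + t • P.e₃)) P.e₃ ^ 2 = 1 := by
  rw [lorentzInner_lorentzCross_add_smul, lorentzInner_lorentzCross_sq, P.inner_e₁_e₁,
    P.inner_e₂_e₂, P.inner_e₃_e₃, P.inner_e₁_e₂, P.inner_e₁_e₃, P.inner_e₂_e₃]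
  norm_num

theorem hasFDerivAt_graphMap {u : R2 → ℝ} {q : R2} (hu : DifferentiableAt ℝ u q) :
    HasFDerivAt (graphMap P u) ((EuclideanSpace.proj 0 : StrongDual ℝ R2).smulRight P.e₁ +
      (EuclideanSpace.proj 1 : StrongDual ℝ R2).smulRight P.e₂ +
      (fderiv ℝ u q).smulRight P.e₃) q := by
  have h (i : Fin 2) : HasFDerivAt (fun q : R2 => q i)
      (EuclideanSpace.proj i : StrongDual ℝ R2) q :=
    (EuclideanSpace.proj i : StrongDual ℝ R2).hasFDerivAt
  exact (((h 0).smul_const P.e₁).const_add P.o).add ((h 1).smul_const P.e₂) |>.add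
    (hu.hasFDerivAt.smul_const P.e₃)

theorem fderiv_graphMap_apply {u : R2 → ℝ} {q : R2} (hu : DifferentiableAt ℝ u q) (v : R2) :
    fderiv ℝ (graphMap P u) q v = v 0 • P.e₁ + v 1 • P.e₂ + fderiv ℝ u q v • P.e₃ := by
  rw [(P.hasFDerivAt_graphMap hu).fderiv]
  simp

theorem partialD_partialD_graphMap {u : R2 → ℝ} {q : R2} (hu : ContDiffAt ℝ 2 u q) (i j : Fin 2) :
    partialD i (partialD j (graphMap P u)) q = fderiv ℝ (fderiv ℝ u) q
      (EuclideanSpace.single i 1) (EuclideanSpace.single j 1) • P.e₃ := by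
  have he : partialD j (graphMap P u) =ᶠ[nhds q] fun p =>
      ((EuclideanSpace.single j 1 : R2) 0 • P.e₁ + (EuclideanSpace.single j 1 : R2) 1 • P.e₂) +
        fderiv ℝ u p (EuclideanSpace.single j 1) • P.e₃ := by
    filter_upwards [hu.eventually (by simp)] with p hp
    exact P.fderiv_graphMap_apply (hp.differentiableAt (by simp)) _
  have hd : HasFDerivAt (fderiv ℝ u) (fderiv ℝ (fderiv ℝ u) q) q :=
    ((hu.fderiv_right (m := 1) (by norm_num)).differentiableAt (by simp)).hasFDerivAt
  have h := ((hd.clm_apply (hasFDerivAt_const (EuclideanSpace.single j (1 : ℝ) : R2) q)).smul_const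
    P.e₃).const_add
    ((EuclideanSpace.single j 1 : R2) 0 • P.e₁ + (EuclideanSpace.single j 1 : R2) 1 • P.e₂)
  rw [partialD, he.fderiv_eq, h.fderiv]
  simp

theorem graphMap_eq_iff {u u' : R2 → ℝ} {q q' : R2} :
    graphMap P u q = graphMap P u' q' ↔ q = q' ∧ u q = u' q' := by
  refine ⟨fun h => ?_, by rintro ⟨rfl, h⟩; simp [graphMap, h]⟩
  have key (a : R3) : q 0 * lorentzInner P.e₁ a + q 1 * lorentzInner P.e₂ a +
      u q * lorentzInner P.e₃ a = q' 0 * lorentzInner P.e₁ a + q' 1 * lorentzInner P.e₂ a +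
      u' q' * lorentzInner P.e₃ a := by
    have := congrArg (fun x => lorentzInner x a) h
    simp only [graphMap, lorentzInner_add_left, lorentzInner_smul_left] at this
    linarith
  have k1 := key P.e₁
  have k2 := key P.e₂
  have k3 := key P.e₃
  simp only [lorentzInner_comm P.e₂ P.e₁, lorentzInner_comm P.e₃ P.e₁,
    lorentzInner_comm P.e₃ P.e₂, P.inner_e₁_e₁, P.inner_e₂_e₂, P.inner_e₃_e₃, P.inner_e₁_e₂,
    P.inner_e₁_e₃, P.inner_e₂_e₃] at k1 k2 k3
  refine ⟨?_, by linarith⟩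
  ext i
  fin_cases i
  · simpa using k1
  · simpa using k2

theorem lorentzInner_tangent (a b c a' b' c' : ℝ) :
    lorentzInner (a • P.e₁ + b • P.e₂ + c • P.e₃) (a' • P.e₁ + b' • P.e₂ + c' • P.e₃) =
      a * a' + b * b' - c * c' := by
  simp only [lorentzInner_add_left, lorentzInner_smul_left, lorentzInner_add_right,
    lorentzInner_smul_right, lorentzInner_comm P.e₂ P.e₁, lorentzInner_comm P.e₃ P.e₁,
    lorentzInner_comm P.e₃ P.e₂, P.inner_e₁_e₁, P.inner_e₂_e₂, P.inner_e₃_e₃, P.inner_e₁_e₂,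
    P.inner_e₁_e₃, P.inner_e₂_e₃]
  ring

theorem solvesMeanCurvatureEquation {u : R2 → ℝ} {q : R2} (hu : ContDiffAt ℝ 2 u q)
    (hs : ∀ v : R2, v ≠ 0 → 0 < lorentzInner (fderiv ℝ (graphMap P u) q v)
      (fderiv ℝ (graphMap P u) q v)) :
    SolvesMeanCurvatureEquation u
      (-2 * P.timeSign * meanCurvature (graphMap P u) q) q := by
  have hd := hu.differentiableAt (by simp)
  set s := fderiv ℝ u q (EuclideanSpace.single 0 1) with hs'
  set t := fderiv ℝ u q (EuclideanSpace.single 1 1) with ht'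
  have hD : 0 < 1 - s ^ 2 - t ^ 2 := by
    by_cases h0 : s = 0 ∧ t = 0
    · rw [h0.1, h0.2]; norm_num
    -- Along its own gradient the graph has squared length `|Du|² (1 - |Du|²)`.
    have := hs (s • EuclideanSpace.single 0 1 + t • EuclideanSpace.single 1 1) (fun h => h0
      ⟨by simpa using congrArg (fun v : R2 => v 0) h, by simpa using congrArg (fun v : R2 => v 1) h⟩)
    rw [P.fderiv_graphMap_apply hd, P.lorentzInner_tangent, map_add, map_smul, map_smul, ← hs',
      ← ht'] at this
    simp at this
    have hpos : 0 < s ^ 2 + t ^ 2 := by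
      rcases not_and_or.1 h0 with h | h <;> positivity
    by_contra! hcon
    nlinarith [mul_nonneg hpos.le (neg_nonneg.2 hcon)]
  have hX0 : partialD 0 (graphMap P u) q = P.e₁ + s • P.e₃ := by
    simp [partialD, P.fderiv_graphMap_apply hd, hs']
  have hX1 : partialD 1 (graphMap P u) q = P.e₂ + t • P.e₃ := by
    simp [partialD, P.fderiv_graphMap_apply hd, ht']
  have hE : lorentzInner (P.e₁ + s • P.e₃) (P.e₁ + s • P.e₃) = 1 - s ^ 2 := by
    have := P.lorentzInner_tangent 1 0 s 1 0 s
    simp at this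
    rw [this]; ring
  have hF : lorentzInner (P.e₁ + s • P.e₃) (P.e₂ + t • P.e₃) = -(s * t) := by
    have := P.lorentzInner_tangent 1 0 s 0 1 t
    simp at this
    rw [this]
  have hG : lorentzInner (P.e₂ + t • P.e₃) (P.e₂ + t • P.e₃) = 1 - t ^ 2 := by
    have := P.lorentzInner_tangent 0 1 t 0 1 t
    simp at this
    rw [this]; ring
  set n := lorentzCross (P.e₁ + s • P.e₃) (P.e₂ + t • P.e₃) with hn
  have hnn : lorentzInner n n = -(1 - s ^ 2 - t ^ 2) := by
    rw [hn, lorentzInner_lorentzCross_self, hE, hF, hG]; ring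
  have hN : lorentzInner (gaussMap (graphMap P u) q) P.e₃ =
      P.timeSign / √(1 - s ^ 2 - t ^ 2) := by
    simp only [gaussMap, hX0, hX1, ← hn, lorentzInner_smul_left, lorentzNorm, hnn, abs_neg,
      abs_of_pos hD]
    rw [← P.sign_mul_lorentzInner (by rw [hnn]; linarith)
      (P.lorentzInner_lorentzCross_e₃_sq s t)]
    ring
  have hW : 0 < √(1 - s ^ 2 - t ^ 2) := Real.sqrt_pos.2 hD
  have hW2 : √(1 - s ^ 2 - t ^ 2) ^ 2 = 1 - s ^ 2 - t ^ 2 := Real.sq_sqrt hD.le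
  refine ⟨hD, ?_⟩
  simp only [meanCurvature, P.partialD_partialD_graphMap hu, hX0, hX1, hE, hF, hG,
    lorentzInner_smul_right, hN]
  rw [← hs', ← ht', show (1 - s ^ 2) * (1 - t ^ 2) - (-(s * t)) ^ 2 = √(1 - s ^ 2 - t ^ 2) ^ 2 by
    rw [hW2]; ring]
  have hσ := P.timeSign_sq
  set W := √(1 - s ^ 2 - t ^ 2)
  field_simp
  rw [hσ]
  ring

end SpacelikePlane

/-! ### Uniqueness of the graph with given boundary -/

theorem CompactSpacelikeGraph.solvesMeanCurvatureEquation {P : SpacelikePlane} {H : ℝ}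
    (S : CompactSpacelikeGraph P) (hH : S.HasConstantMeanCurvature H) {q : R2} (hq : q ∈ S.domain) :
    SolvesMeanCurvatureEquation S.u (-2 * P.timeSign * H) q := by
  have hn : closure S.domain ∈ nhds q :=
    Filter.mem_of_superset (S.isSmoothBoundedDomain.isOpen.mem_nhds hq) subset_closure
  have hs := S.spacelike q (subset_closure hq)
  rw [fderivWithin_of_mem_nhds hn] at hs
  rw [← hH q hq]
  exact P.solvesMeanCurvatureEquation ((S.smooth.contDiffAt hn).of_le ENat.LEInfty.out) hs

theorem CompactSpacelikeGraph.le_of_boundary_eq {P : SpacelikePlane} {H : ℝ}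
    (S₁ S₂ : CompactSpacelikeGraph P) (hH₁ : S₁.HasConstantMeanCurvature H)
    (hH₂ : S₂.HasConstantMeanCurvature H) (hd : S₁.domain = S₂.domain)
    (hu : ∀ q ∈ frontier S₁.domain, S₁.u q = S₂.u q) :
    ∀ q ∈ closure S₁.domain, S₁.u q ≤ S₂.u q :=
  le_of_solvesMeanCurvatureEquation S₁.isSmoothBoundedDomain.isOpen
    S₁.isSmoothBoundedDomain.isBounded
    ((S₁.smooth.mono subset_closure).of_le ENat.LEInfty.out)
    (hd ▸ (S₂.smooth.mono subset_closure).of_le ENat.LEInfty.out)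
    S₁.smooth.continuousOn (hd ▸ S₂.smooth.continuousOn)
    (fun _ hq => S₁.solvesMeanCurvatureEquation hH₁ hq)
    (fun _ hq => S₂.solvesMeanCurvatureEquation hH₂ (hd ▸ hq)) fun q hq => (hu q hq).le

theorem mainTheorem3 (P : SpacelikePlane) (C : Set R3) (H : ℝ) (S₁ S₂ : CompactSpacelikeGraph P)
    (hH₁ : S₁.HasConstantMeanCurvature H) (hH₂ : S₂.HasConstantMeanCurvature H)
    (hC₁ : S₁.boundary = C) (hC₂ : S₂.boundary = C) :
    S₁.carrier = S₂.carrier := by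
  have hsub : ∀ S S' : CompactSpacelikeGraph P, S.boundary = S'.boundary →
      ∀ q ∈ frontier S.domain, q ∈ frontier S'.domain ∧ S.u q = S'.u q := by
    intro S S' h q hq
    have hm : graphMap P S.u q ∈ S'.boundary := h ▸ mem_image_of_mem _ hq
    obtain ⟨q', hq', he⟩ := hm
    obtain ⟨rfl, hu⟩ := P.graphMap_eq_iff.1 he
    exact ⟨hq', hu.symm⟩
  have h₁₂ := hsub S₁ S₂ (hC₁.trans hC₂.symm)
  have h₂₁ := hsub S₂ S₁ (hC₂.trans hC₁.symm)
  have hd : S₁.domain = S₂.domain :=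
    S₁.isSmoothBoundedDomain.eq_of_frontier_eq S₂.isSmoothBoundedDomain
      (Subset.antisymm (fun q hq => (h₁₂ q hq).1) fun q hq => (h₂₁ q hq).1)
  have hu : EqOn S₁.u S₂.u (closure S₁.domain) := fun q hq =>
    le_antisymm (S₁.le_of_boundary_eq S₂ hH₁ hH₂ hd (fun q hq => (h₁₂ q hq).2) q hq)
      (S₂.le_of_boundary_eq S₁ hH₂ hH₁ hd.symm (fun q hq => (h₂₁ q hq).2) q (hd ▸ hq))
  rw [CompactSpacelikeGraph.carrier, CompactSpacelikeGraph.carrier, ← hd]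
  exact image_congr fun q hq => P.graphMap_eq_iff.2 ⟨rfl, hu hq⟩
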